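/- **Setting.** Let $n\in\mathbb N$, let $\mathcal S(n)$ be the real symmetric $n\times n$ matrices, $\mathcal J^2=\mathbb R\times\mathbb R^n\times\mathcal S(n)$, $\mathcal N=\{s\in\mathbb R: s\le 0\}$ and $\mathcal P=\{P\in\mathcal S(n):P\ge 0\}$. For $\mathcal F\subset\mathcal J^2$ let $\widetilde{\mathcal F}=\{J: -J\notin \operatorname{Int}\mathcal F\}$ be its dual. $\mathrm{USC}(X)$ (resp. $\mathrm{LSC}(X)$) denotes the upper (lower) semicontinuous functions on $X\subset\mathbb R^n$ with values in $[-\infty,+\infty)$ (resp. $(-\infty,+\infty]$). For $x_0$ in an open set $X$, $J^{2,+}_{x_0}u$ (resp. $J^{2,-}_{x_0}u$) is the set of jets $(\varphi(x_0),D\varphi(x_0),D^2\varphi(x_0))$, where $\varphi$ is real-valued and $C^2$ near $x_0$, $u\le\varphi$ (resp. $u\ge\varphi$) near $x_0$, and $u(x_0)=\varphi(x_0)$. A function $u\in\mathrm{USC}(X)$ is $\mathcal F$-subharmonic on $X$ if $J^{2,+}_{x_0}u\subset\mathcal F$ for all $x_0\in X$; a function $w \in \mathrm{LSC}(X)$ is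 $\mathcal F$-superharmonic on $X$ if $-w$ is $\widetilde{\mathcal F}$-subharmonic on $X$. A *gradient-free subequation* is a closed set $\emptyset\ne\mathcal F\subsetneq\mathcal J^2$ with $\mathcal F+(\mathcal N\times\mathbb R^n\times\mathcal P)\subset\mathcal F$. A *compatible proper elliptic gradient-free pair* $(F,\mathcal F)$ is given by $\mathcal F=\{(r,p,A)\in\mathcal J^2:(r,A)\in\mathcal G\}$ and $F(r,p,A)=G(r,A)$ on $\mathcal F$, where $\mathcal G\subset\mathbb R\times\mathcal S(n)$ is closed and non-empty, $G:\mathcal G\to\mathbb R$ is continuous, $\mathcal G+(\mathcal N\times\mathcal P)\subset\mathcal G$, $G(r+s,A+P)\ge G(r,A)$ for all $(r,A)\in\mathcal G$ and $(s,P)\in\mathcal N\times\mathcal P$, and either $\mathcal G=\mathbb R\times\mathcal S(n)$, or $c_0=\inf_{\mathcal G}G$ is finite and $\partial\mathcal G=\{(r,A)\in\mathcal G:G(r,A)=c_0\}$. The admissible levels are the numbers $c\in F(\mathcal F)$, and $\mathcal F_c=\{J\in\mathcal F:F(J)\ge c\}$. The operator $F$ is *topologically tame* if $\{J\in\mathcal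 F:F(J)=c\}$ has empty interior for every $c\in\mathbb R$. A function $u\in\mathrm{USC}(\Omega)$ is an *$\mathcal F$-admissible viscosity subsolution* of $F(u,Du,D^2u)=c$ in $\Omega$ if for all $x_0\in\Omega$ every $J\in J^{2,+}_{x_0}u$ satisfies $J\in\mathcal F$ and $F(J)\ge c$; a function $w\in\mathrm{LSC}(\Omega)$ is an *$\mathcal F$-admissible viscosity supersolution* if for all $x_0\in\Omega$ every $J\in J^{2,-}_{x_0}w$ satisfies either ($J\in\mathcal F$ and $F(J)\le c$) or $J\notin\mathcal F$. **Theorem.** Let $\Omega\subset\mathbb R^n$ be any bounded open set (connected or not). 1. Let $\mathcal F$ be a gradient-free subequation, and let $u,v\in\mathrm{USC}(\overline\Omega)$ be respectively $\mathcal F$-subharmonic and $\widetilde{\mathcal F}$-subharmonic on $\Omega$. If $u+v\le 0$ on $\partial\Omega$, then $u+v\le 0$ on $\Omega$. 2. Let $(F,\mathcal F)$ be a compatible proper elliptic gradient-free pair and let $c\in F(\mathcal F)$. Then the comparison principle $$u\le w\ \text{ on }\partial\Omega\quad\Longrightarrow\quad u\le w\ \text{ on }\Omega$$ holds for all $u\in\mathrm{USC}(\overline\Omega)$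 and $w\in\mathrm{LSC}(\overline\Omega)$ such that $u$ is $\mathcal F_c$-subharmonic and $w$ is $\mathcal F_c$-superharmonic on $\Omega$. 3. If, in addition to the hypotheses of 2, $F$ is topologically tame, then a function $u\in\mathrm{USC}(\overline\Omega)$ is an $\mathcal F$-admissible viscosity subsolution of $F(u,Du,D^2u)=c$ in $\Omega$ if and only if it is $\mathcal F_c$-subharmonic on $\Omega$, a function $w\in\mathrm{LSC}(\overline\Omega)$ is an $\mathcal F$-admissible viscosity supersolution of $F(w,Dw,D^2w)=c$ in $\Omega$ if and only if it is $\mathcal F_c$-superharmonic on $\Omega$, and the comparison principle of 2 holds for all $u\in\mathrm{USC}(\overline\Omega)$ and $w\in\mathrm{LSC}(\overline\Omega)$ that are respectively an $\mathcal F$-admissible viscosity subsolution and supersolution of the equation at level $c$ in $\Omega$. -/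

import Mathlib

open Set Filter Topology

/-- Real symmetric `n × n` matrices (with the topology and vector space structure inherited from
all matrices). -/
abbrev SymMat (n : ℕ) : Type := selfAdjoint (Matrix (Fin n) (Fin n) ℝ)

/-- The space of 2-jets `ℝ × ℝⁿ × S(n)`, with coordinates `(r, p, A)`. -/
abbrev Jet2 (n : ℕ) : Type := ℝ × EuclideanSpace ℝ (Fin n) × SymMat n

/-- The reduced jet space `ℝ × S(n)`, with coordinates `(r, A)`. -/
abbrev RJet2 (n : ℕ) : Type := ℝ × SymMat n

/-- The reduced jet `(r, A)` of `(r, p, A)`. -/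
def Jet2.reduce {n : ℕ} (J : Jet2 n) : RJet2 n := (J.1, J.2.2)

/-- `𝒩 × ℝⁿ × 𝒫`: all `(s, q, P)` with `s ≤ 0`, `q` arbitrary and `P ≥ 0`. -/
def negPosCone (n : ℕ) : Set (Jet2 n) :=
  {J | J.1 ≤ 0 ∧ (J.2.2 : Matrix (Fin n) (Fin n) ℝ).PosSemidef}

/-- `𝒬 = 𝒩 × 𝒫`: all `(s, P)` with `s ≤ 0` and `P ≥ 0`. -/
def reducedNegPosCone (n : ℕ) : Set (RJet2 n) :=
  {J | J.1 ≤ 0 ∧ (J.2 : Matrix (Fin n) (Fin n) ℝ).PosSemidef}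

/-- `S` is `M`-monotone: `S + M ⊆ S`. -/
def IsMonotoneSet {V : Type*} [Add V] (M S : Set V) : Prop :=
  ∀ J ∈ S, ∀ J' ∈ M, J + J' ∈ S

/-- The dual `𝓕~ = ∼(-Int 𝓕)` of a constraint set. -/
def dualSet {n : ℕ} (𝓕 : Set (Jet2 n)) : Set (Jet2 n) := {J | -J ∉ interior 𝓕}

/-- Gradient-free subequations: closed, non-empty, proper and `𝒩 × ℝⁿ × 𝒫`-monotone. -/
structure IsGradientFreeSubequation {n : ℕ} (𝓕 : Set (Jet2 n)) : Prop where
  isClosed : IsClosed 𝓕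
  nonempty : 𝓕.Nonempty
  ne_univ : 𝓕 ≠ univ
  monotone : IsMonotoneSet (negPosCone n) 𝓕

/-! ### Semicontinuous functions, test jets, subharmonics -/

/-- `u ∈ USC(X)`: upper semicontinuous on `X` with values in `[-∞, +∞)`. -/
def IsUSC {n : ℕ} (u : EuclideanSpace ℝ (Fin n) → EReal)
    (X : Set (EuclideanSpace ℝ (Fin n))) : Prop :=
  UpperSemicontinuousOn u X ∧ ∀ x ∈ X, u x ≠ ⊤

/-- `w ∈ LSC(X)`: lower semicontinuous on `X` with values in `(-∞, +∞]`. -/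
def IsLSC {n : ℕ} (w : EuclideanSpace ℝ (Fin n) → EReal)
    (X : Set (EuclideanSpace ℝ (Fin n))) : Prop :=
  LowerSemicontinuousOn w X ∧ ∀ x ∈ X, w x ≠ ⊥

/-- `J = (φ(x), Dφ(x), D²φ(x))`. -/
def IsJetAt {n : ℕ} (φ : EuclideanSpace ℝ (Fin n) → ℝ) (x : EuclideanSpace ℝ (Fin n))
    (J : Jet2 n) : Prop :=
  J.1 = φ x ∧ J.2.1 = gradient φ x ∧
    ∀ i j : Fin n, (J.2.2 : Matrix (Fin n) (Fin n) ℝ) i j =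
      fderiv ℝ (fderiv ℝ φ) x (EuclideanSpace.single i 1) (EuclideanSpace.single j 1)

/-- The upper test jets of `u` at `x₀`: the 2-jets at `x₀` of the functions `φ` that are `C²` near
`x₀` and satisfy `u ≤ φ` near `x₀`, `u(x₀) = φ(x₀)`. -/
def upperTestJets {n : ℕ} (u : EuclideanSpace ℝ (Fin n) → EReal)
    (x₀ : EuclideanSpace ℝ (Fin n)) : Set (Jet2 n) :=
  {J | ∃ φ : EuclideanSpace ℝ (Fin n) → ℝ, ContDiffAt ℝ 2 φ x₀ ∧
    (∀ᶠ x in 𝓝 x₀, u x ≤ (φ x : EReal)) ∧ u x₀ = (φ x₀ : EReal) ∧ IsJetAt φ x₀ J}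

/-- The lower test jets of `w` at `x₀`: the 2-jets at `x₀` of the functions `φ` that are `C²` near
`x₀` and satisfy `w ≥ φ` near `x₀`, `w(x₀) = φ(x₀)`. -/
def lowerTestJets {n : ℕ} (w : EuclideanSpace ℝ (Fin n) → EReal)
    (x₀ : EuclideanSpace ℝ (Fin n)) : Set (Jet2 n) :=
  {J | ∃ φ : EuclideanSpace ℝ (Fin n) → ℝ, ContDiffAt ℝ 2 φ x₀ ∧
    (∀ᶠ x in 𝓝 x₀, (φ x : EReal) ≤ w x) ∧ w x₀ = (φ x₀ : EReal) ∧ IsJetAt φ x₀ J}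

/-- `u` is `𝓕`-subharmonic on the open set `X`. -/
def IsSubharmonic {n : ℕ} (𝓕 : Set (Jet2 n)) (u : EuclideanSpace ℝ (Fin n) → EReal)
    (X : Set (EuclideanSpace ℝ (Fin n))) : Prop :=
  IsUSC u X ∧ ∀ x ∈ X, upperTestJets u x ⊆ 𝓕

/-- `w` is `𝓕`-superharmonic on the open set `X`: `-w` is `𝓕~`-subharmonic. -/
def IsSuperharmonic {n : ℕ} (𝓕 : Set (Jet2 n)) (w : EuclideanSpace ℝ (Fin n) → EReal)
    (X : Set (EuclideanSpace ℝ (Fin n))) : Prop :=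
  IsSubharmonic (dualSet 𝓕) (fun x => -w x) X

/-! ### Operators. A real function on a subset is given by a function on the whole space, of which
only the values on the subset are used. -/

/-- The conditions on a reduced pair `(G, 𝒢)` with `G ∈ C(𝒢)`: `𝒢` is closed and non-empty, `𝒢` and
`G` are `𝒬`-monotone, and either `𝒢` is everything (unconstrained case) or `c₀ = inf G` is finite
and `∂𝒢 = {G = c₀}` (constrained case). -/
structure IsReducedCompatiblePair {n : ℕ} (G : RJet2 n → ℝ) (𝒢 : Set (RJet2 n)) : Prop where
  isClosed : IsClosed 𝒢
  nonempty : 𝒢.Nonempty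
  continuousOn : ContinuousOn G 𝒢
  monotone_set : IsMonotoneSet (reducedNegPosCone n) 𝒢
  monotone_fun : ∀ J ∈ 𝒢, ∀ J' ∈ reducedNegPosCone n, G J ≤ G (J + J')
  compatible : 𝒢 = univ ∨
    ∃ c₀ : ℝ, IsGLB (G '' 𝒢) c₀ ∧ frontier 𝒢 = {J | J ∈ 𝒢 ∧ G J = c₀}

/-- `(F, 𝓕)` is a compatible proper elliptic gradient-free operator-subequation pair:
`𝓕 = {(r, p, A) : (r, A) ∈ 𝒢}` and `F(r, p, A) = G(r, A)` on `𝓕`, with `(G, 𝒢)` as above. -/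
def IsGradientFreePair {n : ℕ} (F : Jet2 n → ℝ) (𝓕 : Set (Jet2 n)) : Prop :=
  ∃ (G : RJet2 n → ℝ) (𝒢 : Set (RJet2 n)), IsReducedCompatiblePair G 𝒢 ∧
    𝓕 = {J | J.reduce ∈ 𝒢} ∧ ∀ J ∈ 𝓕, F J = G J.reduce

/-- The upper level set `𝓕_c = {J ∈ 𝓕 : F(J) ≥ c}`. -/
def upperLevelSet {n : ℕ} (F : Jet2 n → ℝ) (𝓕 : Set (Jet2 n)) (c : ℝ) : Set (Jet2 n) :=
  {J | J ∈ 𝓕 ∧ c ≤ F J}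

/-- `F` is topologically tame on `𝓕`: all level sets have empty interior. -/
def IsTopologicallyTame {n : ℕ} (F : Jet2 n → ℝ) (𝓕 : Set (Jet2 n)) : Prop :=
  ∀ c : ℝ, interior {J | J ∈ 𝓕 ∧ F J = c} = ∅

/-- `u` is an `𝓕`-admissible viscosity subsolution of `F(u, Du, D²u) = c` in `Ω`. -/
def IsAdmissibleSubsolution {n : ℕ} (F : Jet2 n → ℝ) (𝓕 : Set (Jet2 n)) (c : ℝ)
    (u : EuclideanSpace ℝ (Fin n) → EReal) (Ω : Set (EuclideanSpace ℝ (Fin n))) : Prop :=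
  IsUSC u Ω ∧ ∀ x ∈ Ω, ∀ J ∈ upperTestJets u x, J ∈ 𝓕 ∧ c ≤ F J

/-- `w` is an `𝓕`-admissible viscosity supersolution of `F(w, Dw, D²w) = c` in `Ω`. -/
def IsAdmissibleSupersolution {n : ℕ} (F : Jet2 n → ℝ) (𝓕 : Set (Jet2 n)) (c : ℝ)
    (w : EuclideanSpace ℝ (Fin n) → EReal) (Ω : Set (EuclideanSpace ℝ (Fin n))) : Prop :=
  IsLSC w Ω ∧ ∀ x ∈ Ω, ∀ J ∈ lowerTestJets w x, (J ∈ 𝓕 ∧ F J ≤ c) ∨ J ∉ 𝓕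

/-! Suppose `u + v` is positive somewhere. Truncate both functions from below, add `ε / 2 * ‖x‖ ^ 2`
to `u`, and double the variables with a penalty so strong that maximum points lie in `Ω × Ω`. If at
such a maximum the two functions have second order upper expansions with opposite quadratic parts,
then the `ε` term makes minus the jet of `v` equal to the jet of `u` plus an interior element of
`negPosCone`. It is thus interior to `𝓕`, against the definition of `dualSet`. The two gradients
need not match, because the cone contains every gradient direction; so one fixed penalty suffices
and no limit is taken.

The expansions come from `exists_doubled_expansions`. The regularization `lasryLions k K U` is
`C^{1,1}`. At the point `x₀` attached to a maximum of `doubled`, it is touched from below by a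
translate of `U` and from above by a translate of `-V` plus an affine function, so its Hessian at
`x₀` serves both. To have a Hessian there, let the perturbation `r` vary in a ball: the sum of the
gradients of the two regularizations is a Lipschitz map sending the points `x₀` onto a ball. These
points therefore do not form a null set, and Rademacher's theorem, applied to the gradient, gives
one where it is differentiable.

Comparison needs only monotonicity, so it applies to upper level sets of an operator. For the
equation, `mem_interior` and `lt_of_mem_interior` identify the interior of the level set with `{F >
c}`, which turns duality into the supersolution condition. -/

/-! ### `C^{1,1}` regularization by sup- and inf-convolution. -/

section LasryLions

variable {E : Type*} [NormedAddCommGroup E]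

/-- The sup-convolution `sup_{y ∈ K} (U y - k / 2 * |z - y|²)`. -/
noncomputable def supConv (k : ℝ) (K : Set E) (U : E → ℝ) (z : E) : ℝ :=
  ⨆ y : K, (U y - k / 2 * ‖z - y‖ ^ 2)

/-- The Lasry-Lions regularization of `U` on `K`: an inf-convolution of a sup-convolution. -/
noncomputable def lasryLions (k : ℝ) (K : Set E) (U : E → ℝ) (x : E) : ℝ :=
  ⨅ z : E, (supConv k K U z + k * ‖x - z‖ ^ 2)

variable {k : ℝ} {K : Set E} {U : E → ℝ}

lemma bddAbove_range_supConv (hk : 0 < k) (hU : BddAbove (U '' K)) (z : E) :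
    BddAbove (range fun y : K => U y - k / 2 * ‖z - y‖ ^ 2) := by
  obtain ⟨B, hB⟩ := hU
  refine ⟨B, ?_⟩
  rintro _ ⟨y, rfl⟩
  have := hB (mem_image_of_mem U y.2)
  have : 0 ≤ k / 2 * ‖z - y‖ ^ 2 := by positivity
  simp only
  linarith

lemma le_supConv (hk : 0 < k) (hU : BddAbove (U '' K)) {y : E} (hy : y ∈ K) (z : E) :
    U y - k / 2 * ‖z - y‖ ^ 2 ≤ supConv k K U z :=
  le_ciSup (bddAbove_range_supConv hk hU z) ⟨y, hy⟩

lemma supConv_le (hK : K.Nonempty) {z : E} {c : ℝ}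
    (h : ∀ y ∈ K, U y - k / 2 * ‖z - y‖ ^ 2 ≤ c) : supConv k K U z ≤ c := by
  have := hK.to_subtype
  exact ciSup_le fun y => h y y.2

lemma lowerSemicontinuous_supConv (hk : 0 < k) (hU : BddAbove (U '' K)) :
    LowerSemicontinuous (supConv k K U) := by
  refine lowerSemicontinuous_ciSup (bddAbove_range_supConv hk hU) fun y => ?_
  exact Continuous.lowerSemicontinuous (by fun_prop)

variable [InnerProductSpace ℝ E]

lemma norm_add_sq_add_norm_sub_sq (a b : E) :
    ‖a + b‖ ^ 2 + ‖a - b‖ ^ 2 = 2 * ‖a‖ ^ 2 + 2 * ‖b‖ ^ 2 := by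
  rw [norm_add_sq_real, norm_sub_sq_real]; ring

lemma supConv_midpoint (hk : 0 < k) (hK : K.Nonempty) (hU : BddAbove (U '' K)) (z d : E) :
    2 * supConv k K U z - k * ‖d‖ ^ 2 ≤ supConv k K U (z + d) + supConv k K U (z - d) := by
  have : supConv k K U z ≤
      (supConv k K U (z + d) + supConv k K U (z - d) + k * ‖d‖ ^ 2) / 2 := by
    refine supConv_le hK fun y hy => ?_
    have h1 := le_supConv hk hU hy (z + d)
    have h2 := le_supConv hk hU hy (z - d)
    have h3 := norm_add_sq_add_norm_sub_sq (z - y) d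
    rw [show z + d - y = z - y + d by abel] at h1
    rw [show z - d - y = z - y - d by abel] at h2
    nlinarith
  linarith

/-- The parallelogram law gives `‖z - y‖ ^ 2 ≤ 2 * ‖x - y‖ ^ 2 + 2 * ‖x - z‖ ^ 2`; this fixes the
pair of constants `k / 2` and `k` in the two convolutions. -/
lemma sub_sq_le_supConv_add (hk : 0 < k) (hU : BddAbove (U '' K)) {y : E} (hy : y ∈ K) (x z : E) :
    U y - k * ‖x - y‖ ^ 2 ≤ supConv k K U z + k * ‖x - z‖ ^ 2 := by
  have h1 := le_supConv hk hU hy z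
  have h2 := norm_add_sq_add_norm_sub_sq (x - y) (x - z)
  rw [show x - y - (x - z) = z - y by abel] at h2
  nlinarith [sq_nonneg ‖x - y + (x - z)‖]

lemma bddBelow_range_lasryLions (hk : 0 < k) (hK : K.Nonempty) (hU : BddAbove (U '' K)) (x : E) :
    BddBelow (range fun z : E => supConv k K U z + k * ‖x - z‖ ^ 2) := by
  obtain ⟨y, hy⟩ := hK
  refine ⟨U y - k * ‖x - y‖ ^ 2, ?_⟩
  rintro _ ⟨z, rfl⟩
  exact sub_sq_le_supConv_add hk hU hy x z

lemma lasryLions_le (hk : 0 < k) (hK : K.Nonempty) (hU : BddAbove (U '' K)) (x z : E) :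
    lasryLions k K U x ≤ supConv k K U z + k * ‖x - z‖ ^ 2 :=
  ciInf_le (bddBelow_range_lasryLions hk hK hU x) z

lemma sub_sq_le_lasryLions (hk : 0 < k) (hU : BddAbove (U '' K)) {y : E} (hy : y ∈ K) (x : E) :
    U y - k * ‖x - y‖ ^ 2 ≤ lasryLions k K U x :=
  le_ciInf fun z => sub_sq_le_supConv_add hk hU hy x z

/-- Paraboloids `c + k * |x - z|²` above `sup_{y ∈ K} (U y - k * |x - y|²)` are above the
regularization. -/
lemma lasryLions_le_paraboloid (hk : 0 < k) (hK : K.Nonempty) (hU : BddAbove (U '' K)) {z : E}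
    {c : ℝ} (h : ∀ x, ∀ y ∈ K, U y - k * ‖x - y‖ ^ 2 ≤ c + k * ‖x - z‖ ^ 2) (x : E) :
    lasryLions k K U x ≤ c + k * ‖x - z‖ ^ 2 := by
  refine (lasryLions_le hk hK hU x z).trans ?_
  gcongr
  refine supConv_le hK fun y hy => ?_
  -- At the midpoint each paraboloid contributes `k / 4 * ‖z - y‖ ^ 2`, together exactly the penalty
  -- of `supConv`.
  have h1 := h ((1 / 2 : ℝ) • (y + z)) y hy
  rw [show (1 / 2 : ℝ) • (y + z) - y = (1 / 2 : ℝ) • (z - y) by module,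
    show (1 / 2 : ℝ) • (y + z) - z = -((1 / 2 : ℝ) • (z - y)) by module, norm_neg, norm_smul,
    Real.norm_of_nonneg (by norm_num)] at h1
  nlinarith

lemma exists_lasryLions_eq [ProperSpace E] (hk : 0 < k) (hK : K.Nonempty)
    (hU : BddAbove (U '' K)) (x : E) :
    ∃ z, lasryLions k K U x = supConv k K U z + k * ‖x - z‖ ^ 2 := by
  obtain ⟨y, hy⟩ := hK
  set g : E → ℝ := fun z => supConv k K U z + k * ‖x - z‖ ^ 2 with hg
  have hlsc : LowerSemicontinuous g :=
    (lowerSemicontinuous_supConv hk hU).add (Continuous.lowerSemicontinuous (by fun_prop))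
  have hSx : U y - k / 2 * ‖x - y‖ ^ 2 ≤ supConv k K U x := le_supConv hk hU hy x
  -- Beyond radius `R` we have `t ≥ 4 * a`, so the loss `k / 2 * (t + a) ^ 2` is at most `25 / 32 *
  -- k * t ^ 2` and the term `k * t ^ 2` wins.
  set a := ‖x - y‖ with ha
  set R : ℝ := 4 * a + 1 + 8 / k * (supConv k K U x - U y + k * a ^ 2) with hR
  have ha0 : 0 ≤ a := norm_nonneg _
  have hD : 0 ≤ supConv k K U x - U y + k * a ^ 2 := by nlinarith [sq_nonneg a]
  have hR0 : 0 ≤ R := by positivity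
  have hxmem : x ∈ Metric.closedBall x R := Metric.mem_closedBall_self hR0
  obtain ⟨z, -, hz⟩ := LowerSemicontinuousOn.exists_isMinOn ⟨x, hxmem⟩
    (isCompact_closedBall x R) (hlsc.lowerSemicontinuousOn _)
  have hmin : ∀ w, g z ≤ g w := by
    intro w
    by_cases hw : w ∈ Metric.closedBall x R
    · exact hz hw
    · refine (hz hxmem).trans ?_
      rw [Metric.mem_closedBall, not_le, dist_eq_norm, ← norm_neg, neg_sub] at hw
      have h1 := le_supConv hk hU hy w
      have h2 : ‖w - y‖ ≤ ‖x - w‖ + a := by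
        rw [show w - y = (x - y) - (x - w) by abel]
        exact (norm_sub_le _ _).trans (by rw [add_comm])
      have h3 : ‖w - y‖ ^ 2 ≤ (‖x - w‖ + a) ^ 2 := by gcongr
      simp only [hg, sub_self, norm_zero]
      set t := ‖x - w‖ with ht
      have h4 : 8 / k * (supConv k K U x - U y + k * a ^ 2) + 1 + 4 * a ≤ t := by
        rw [hR] at hw; linarith
      have h5 : 0 ≤ 8 / k * (supConv k K U x - U y + k * a ^ 2) := by positivity
      have h6 : supConv k K U x - U y + k * a ^ 2 ≤ k / 8 * t ^ 2 := by
        have : 8 / k * (supConv k K U x - U y + k * a ^ 2) ≤ t ^ 2 := by nlinarith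
        calc _ = k / 8 * (8 / k * (supConv k K U x - U y + k * a ^ 2)) := by field_simp
          _ ≤ _ := by gcongr
      have h7 : (t + a) ^ 2 ≤ 25 / 16 * t ^ 2 := by nlinarith
      nlinarith [mul_le_mul_of_nonneg_left (h3.trans h7) hk.le, mul_nonneg hk.le (sq_nonneg a),
        mul_nonneg hk.le (sq_nonneg t)]
  exact ⟨z, le_antisymm (lasryLions_le hk ⟨y, hy⟩ hU x z) (le_ciInf hmin)⟩

/-- Semiconvexity: it survives the infimum because the penalty `k` exceeds the semiconvexity
constant `k / 2` of `supConv`. -/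
lemma lasryLions_midpoint [ProperSpace E] (hk : 0 < k) (hK : K.Nonempty) (hU : BddAbove (U '' K))
    (x v : E) :
    2 * lasryLions k K U x - 2 * k * ‖v‖ ^ 2 ≤
      lasryLions k K U (x + v) + lasryLions k K U (x - v) := by
  obtain ⟨z₁, h₁⟩ := exists_lasryLions_eq hk hK hU (x + v)
  obtain ⟨z₂, h₂⟩ := exists_lasryLions_eq hk hK hU (x - v)
  set z := (1 / 2 : ℝ) • (z₁ + z₂) with hz
  set d := (1 / 2 : ℝ) • (z₁ - z₂) with hd
  have e₁ : z₁ = z + d := by rw [hz, hd]; module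
  have e₂ : z₂ = z - d := by rw [hz, hd]; module
  have h3 := supConv_midpoint hk hK hU z d
  have h4 := lasryLions_le hk hK hU x z
  have h5 := norm_add_sq_add_norm_sub_sq (x - z) (v - d)
  rw [h₁, h₂, e₁, e₂, show x + v - (z + d) = x - z + (v - d) by abel,
    show x - v - (z - d) = x - z - (v - d) by abel]
  -- The remaining error is `2 * ‖v - d‖ ^ 2 - ‖d‖ ^ 2 + 2 * ‖v‖ ^ 2`, which is this square.
  have h6 : 0 ≤ ‖(2 : ℝ) • v - d‖ ^ 2 := sq_nonneg _
  rw [norm_sub_sq_real, norm_smul, inner_smul_left, Real.norm_of_nonneg (by norm_num)] at h6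
  rw [norm_sub_sq_real v d] at h5
  simp only [conj_trivial] at h6
  nlinarith [mul_nonneg hk.le h6, congrArg (k * ·) h5]

/-- Semiconcavity: the paraboloid centred at a minimizer `z` touches the infimum from above. -/
lemma exists_lasryLions_add_le [ProperSpace E] (hk : 0 < k) (hK : K.Nonempty)
    (hU : BddAbove (U '' K)) (x : E) :
    ∃ p : E, ∀ v, lasryLions k K U (x + v) ≤ lasryLions k K U x + inner ℝ p v + k * ‖v‖ ^ 2 := by
  obtain ⟨z, hz⟩ := exists_lasryLions_eq hk hK hU x
  refine ⟨(2 * k) • (x - z), fun v => (lasryLions_le hk hK hU (x + v) z).trans ?_⟩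
  rw [hz, show x + v - z = x - z + v by abel, norm_add_sq_real, inner_smul_left]
  simp only [conj_trivial]
  linarith

lemma exists_abs_lasryLions_sub_le [ProperSpace E] (hk : 0 < k) (hK : K.Nonempty)
    (hU : BddAbove (U '' K)) :
    ∃ P : E → E, ∀ x v, |lasryLions k K U (x + v) - lasryLions k K U x - inner ℝ (P x) v| ≤
      3 * k * ‖v‖ ^ 2 := by
  choose P hP using exists_lasryLions_add_le hk hK hU
  refine ⟨P, fun x v => abs_le.2 ⟨?_, ?_⟩⟩
  · have h1 := hP x (-v)
    have h2 := lasryLions_midpoint hk hK hU x v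
    rw [← sub_eq_add_neg, inner_neg_right, norm_neg] at h1
    linarith
  · have h1 := hP x v
    nlinarith [mul_nonneg hk.le (sq_nonneg ‖v‖)]

end LasryLions

/-! ### First and second order expansions of `C^{1,1}` functions. -/

section SecondOrder

variable {E : Type*} [NormedAddCommGroup E] [InnerProductSpace ℝ E]

lemma eq_zero_of_inner_ge {a : E} {C : ℝ} (h : ∀ v, -(C * ‖v‖ ^ 2) ≤ inner ℝ a v) : a = 0 := by
  by_contra ha
  have ha' : 0 < ‖a‖ ^ 2 := by positivity
  have hC : ∀ t > (0 : ℝ), 1 ≤ C * t := by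
    intro t ht
    have := h (-(t • a))
    rw [inner_neg_right, inner_smul_right, real_inner_self_eq_norm_sq, norm_neg, norm_smul,
      Real.norm_of_nonneg ht.le] at this
    have h2 : 0 ≤ (t * ‖a‖ ^ 2) * (C * t - 1) := by nlinarith
    have h3 : 0 < t * ‖a‖ ^ 2 := by positivity
    nlinarith [nonneg_of_mul_nonneg_right h2 h3]
  have h1 := hC 1 one_pos
  have h2 := hC (1 / (2 * C)) (by rw [mul_one] at h1; positivity)
  have : C ≠ 0 := by rintro rfl; norm_num at h1
  field_simp at h2
  norm_num at h2

variable {h : E → ℝ} {P : E → E} {C : ℝ}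

lemma lipschitz_of_abs_sub_sub_inner_le
    (hP : ∀ x v, |h (x + v) - h x - inner ℝ (P x) v| ≤ C * ‖v‖ ^ 2) (hC : 0 ≤ C) :
    LipschitzWith (Real.toNNReal (6 * C)) P := by
  refine LipschitzWith.of_dist_le_mul fun y x => ?_
  rw [dist_eq_norm, dist_eq_norm, Real.coe_toNNReal _ (by positivity)]
  set d := y - x with hd
  have key : ∀ w, inner ℝ (P y - P x) w ≤ C * (‖d + w‖ ^ 2 + ‖w‖ ^ 2 + ‖d‖ ^ 2) := by
    intro w
    have h1 := (abs_le.1 (hP x (d + w))).2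
    have h2 := (abs_le.1 (hP y w)).1
    have h3 := (abs_le.1 (hP x d)).1
    rw [show x + (d + w) = y + w by rw [hd]; abel, inner_add_right] at h1
    rw [show x + d = y by rw [hd]; abel] at h3
    rw [inner_sub_left]
    linarith
  by_cases ha : P y - P x = 0
  · rw [ha, norm_zero]; positivity
  have ha' : 0 < ‖P y - P x‖ := norm_pos_iff.2 ha
  rcases (norm_nonneg d).eq_or_lt with hd0 | hd0
  · have : y = x := by rwa [eq_comm, norm_eq_zero, hd, sub_eq_zero] at hd0
    rw [this, sub_self] at ha; exact absurd rfl ha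
  -- Take `w` of length `‖d‖` in the direction of `P y - P x`; then `‖d + w‖ ≤ 2 * ‖d‖`, and the
  -- constants add up to `4 + 1 + 1 = 6`.
  have h1 := key ((‖d‖ / ‖P y - P x‖) • (P y - P x))
  have h2 : ‖(‖d‖ / ‖P y - P x‖) • (P y - P x)‖ = ‖d‖ := by
    rw [norm_smul, Real.norm_of_nonneg (by positivity)]; field_simp
  have h3 : ‖d + (‖d‖ / ‖P y - P x‖) • (P y - P x)‖ ^ 2 ≤ (2 * ‖d‖) ^ 2 := by
    gcongr
    exact (norm_add_le _ _).trans (by rw [h2]; linarith)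
  rw [inner_smul_right, real_inner_self_eq_norm_sq, h2] at h1
  have h4 : ‖d‖ / ‖P y - P x‖ * ‖P y - P x‖ ^ 2 = ‖d‖ * ‖P y - P x‖ := by field_simp
  rw [h4] at h1
  have h5 : ‖d‖ * ‖P y - P x‖ ≤ ‖d‖ * (6 * C * ‖d‖) := by nlinarith
  exact le_of_mul_le_mul_left h5 hd0

lemma hasFDerivAt_of_abs_sub_sub_inner_le
    (hP : ∀ x v, |h (x + v) - h x - inner ℝ (P x) v| ≤ C * ‖v‖ ^ 2) (x : E) :
    HasFDerivAt h (innerSL ℝ (P x)) x := by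
  rw [hasFDerivAt_iff_isLittleO_nhds_zero]
  refine Asymptotics.IsBigO.trans_isLittleO (g := fun v : E => ‖v‖ ^ 2) ?_ ?_
  · refine Asymptotics.IsBigO.of_bound C (Eventually.of_forall fun v => ?_)
    simpa using hP x v
  · exact Asymptotics.isLittleO_norm_pow_id one_lt_two

/-- Second order Taylor expansion at a point where the gradient is differentiable. -/
lemma eventually_abs_taylor_two_le (hh : ∀ x, HasFDerivAt h (innerSL ℝ (P x)) x) {x : E}
    {A : E →L[ℝ] E} (hA : HasFDerivAt P A x) {η : ℝ} (hη : 0 < η) :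
    ∀ᶠ v in 𝓝 (0 : E),
      |h (x + v) - h x - inner ℝ (P x) v - 1 / 2 * inner ℝ (A v) v| ≤ η * ‖v‖ ^ 2 := by
  have h1 := (hasFDerivAt_iff_isLittleO_nhds_zero.1 hA).def hη
  obtain ⟨r, hr, hball⟩ := Metric.eventually_nhds_iff_ball.1 h1
  filter_upwards [Metric.ball_mem_nhds (0 : E) hr] with v hv
  set g : ℝ → ℝ := fun t => h (x + t • v) - t * inner ℝ (P x) v - t ^ 2 / 2 * inner ℝ (A v) v
  have hg : ∀ t ∈ Icc (0 : ℝ) 1, HasDerivWithinAt g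
      (inner ℝ (P (x + t • v)) v - inner ℝ (P x) v - t * inner ℝ (A v) v) (Icc 0 1) t := by
    intro t _
    have e1 : HasDerivAt (fun t : ℝ => x + t • v) v t := by
      simpa using ((hasDerivAt_id t).smul_const v).const_add x
    have e2 := (hh (x + t • v)).comp_hasDerivAt t e1
    have e3 := (e2.sub ((hasDerivAt_id t).mul_const (inner ℝ (P x) v))).sub
      ((((hasDerivAt_id t).pow 2).div_const 2).mul_const (inner ℝ (A v) v))
    refine (e3.congr_deriv ?_).hasDerivWithinAt
    simp
  have hbd : ∀ t ∈ Ico (0 : ℝ) 1,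
      ‖inner ℝ (P (x + t • v)) v - inner ℝ (P x) v - t * inner ℝ (A v) v‖ ≤ η * ‖v‖ ^ 2 := by
    intro t ht
    have htv : ‖t • v‖ ≤ ‖v‖ := by
      rw [norm_smul, Real.norm_of_nonneg ht.1]
      exact mul_le_of_le_one_left (norm_nonneg _) ht.2.le
    have e1 := hball (t • v) (by
      rw [mem_ball_zero_iff] at hv ⊢
      exact htv.trans_lt hv)
    have e2 : inner ℝ (P (x + t • v)) v - inner ℝ (P x) v - t * inner ℝ (A v) v =
        inner ℝ (P (x + t • v) - P x - A (t • v)) v := by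
      rw [inner_sub_left, inner_sub_left, map_smul, inner_smul_left]; simp
    rw [e2]
    calc _ ≤ ‖P (x + t • v) - P x - A (t • v)‖ * ‖v‖ := norm_inner_le_norm _ _
      _ ≤ (η * ‖v‖) * ‖v‖ := by gcongr; exact e1.trans (by gcongr)
      _ = _ := by ring
  have := norm_image_sub_le_of_norm_deriv_le_segment_01' hg hbd
  simp only [g, one_smul, zero_smul, add_zero, Real.norm_eq_abs] at this
  convert this using 2
  ring

end SecondOrder

/-! ### Maxima of the doubled functional and contact with the regularization. -/

section Doubling

variable {E : Type*} [NormedAddCommGroup E] [InnerProductSpace ℝ E]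

/-- The doubled functional `U a + V b - k / 2 * |a - b|²` with a linear perturbation. -/
noncomputable def doubled (k : ℝ) (U V : E → ℝ) (r : E) (z : E × E) : ℝ :=
  U z.1 + V z.2 - k / 2 * ‖z.1 - z.2‖ ^ 2 - 2 * k * inner ℝ r (z.1 + z.2)

lemma doubled_swap (k : ℝ) (U V : E → ℝ) (r : E) (a b : E) :
    doubled k U V r (a, b) = doubled k V U r (b, a) := by
  simp only [doubled]
  rw [norm_sub_rev, add_comm a b]
  ring

/-- Maximizing over `x` the sum of `U a - k * ‖x - a‖ ^ 2` and `V b - k * ‖x - b‖ ^ 2`, tilted by `4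
* k * inner ℝ r x`, gives `doubled` up to a constant, with optimal `x = (a + b) / 2 - r`. -/
lemma doubling_identity (k : ℝ) (x a b r : E) :
    k * ‖x - a‖ ^ 2 + k * ‖x - b‖ ^ 2 + 4 * k * inner ℝ r x =
      k / 2 * ‖a - b‖ ^ 2 + 2 * k * inner ℝ r (a + b) +
        2 * k * ‖x - ((1 / 2 : ℝ) • (a + b) - r)‖ ^ 2 - 2 * k * ‖r‖ ^ 2 := by
  simp only [← real_inner_self_eq_norm_sq, inner_sub_left, inner_sub_right, inner_add_left,
    inner_add_right, inner_smul_left, inner_smul_right, conj_trivial]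
  rw [real_inner_comm x a, real_inner_comm x b, real_inner_comm x r, real_inner_comm a b,
    real_inner_comm a r, real_inner_comm b r]
  ring

/-- Absorbs the tilt into the centre of the paraboloid, so that `lasryLions_le_paraboloid` applies.
-/
lemma completed_square (k : ℝ) (x b r : E) :
    k * ‖x - b‖ ^ 2 + 4 * k * inner ℝ r x =
      k * ‖x - (b - (2 : ℝ) • r)‖ ^ 2 + 4 * k * inner ℝ r b - 4 * k * ‖r‖ ^ 2 := by
  simp only [← real_inner_self_eq_norm_sq, inner_sub_left, inner_sub_right, inner_smul_left,
    inner_smul_right, conj_trivial]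
  rw [real_inner_comm x b, real_inner_comm x r, real_inner_comm b r]
  ring

variable {k : ℝ} {K : Set E} {U V : E → ℝ} {r y y' : E}

/-- At a maximum of the doubled functional, the regularization of `U` is bounded above in terms of
`V`. -/
lemma lasryLions_le_of_isMaxOn_doubled (hk : 0 < k) (hU : BddAbove (U '' K)) (hy : y ∈ K)
    (hmax : IsMaxOn (doubled k U V r) (K ×ˢ K) (y, y')) {x₀ : E}
    (hx₀ : x₀ = (1 / 2 : ℝ) • (y + y') - r) (x : E) {b : E} (hb : b ∈ K) :
    lasryLions k K U x ≤ k * ‖x - b‖ ^ 2 - V b + 4 * k * inner ℝ r (x - x₀) +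
      (U y - k * ‖x₀ - y‖ ^ 2) + (V y' - k * ‖x₀ - y'‖ ^ 2) := by
  have h0 := doubling_identity k x₀ y y' r
  rw [← hx₀, sub_self, norm_zero] at h0
  have key : ∀ x, ∀ a ∈ K, U a - k * ‖x - a‖ ^ 2 ≤
      k * ‖x - b‖ ^ 2 - V b + 4 * k * inner ℝ r (x - x₀) +
      (U y - k * ‖x₀ - y‖ ^ 2) + (V y' - k * ‖x₀ - y'‖ ^ 2) := by
    intro x a ha
    have h1 : doubled k U V r (a, b) ≤ doubled k U V r (y, y') := hmax (mk_mem_prod ha hb)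
    have h2 := doubling_identity k x a b r
    have h3 : 0 ≤ 2 * k * ‖x - ((1 / 2 : ℝ) • (a + b) - r)‖ ^ 2 := by positivity
    simp only [doubled] at h1
    rw [inner_sub_right]
    linarith
  have h4 := fun x => completed_square k x b r
  have h5 := lasryLions_le_paraboloid hk ⟨y, hy⟩ hU (z := b - (2 : ℝ) • r)
    (c := 4 * k * inner ℝ r b - 4 * k * ‖r‖ ^ 2 - V b - 4 * k * inner ℝ r x₀ +
      (U y - k * ‖x₀ - y‖ ^ 2) + (V y' - k * ‖x₀ - y'‖ ^ 2))
    (fun x a ha => by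
      have h5 := key x a ha
      have h6 := h4 x
      rw [inner_sub_right] at h5
      linarith) x
  have h6 := h4 x
  rw [inner_sub_right]
  linarith

lemma lasryLions_eq_of_isMaxOn_doubled (hk : 0 < k) (hU : BddAbove (U '' K)) (hy : y ∈ K)
    (hy' : y' ∈ K) (hmax : IsMaxOn (doubled k U V r) (K ×ˢ K) (y, y')) {x₀ : E}
    (hx₀ : x₀ = (1 / 2 : ℝ) • (y + y') - r) :
    lasryLions k K U x₀ = U y - k * ‖x₀ - y‖ ^ 2 := by
  refine le_antisymm ?_ (sub_sq_le_lasryLions hk hU hy x₀)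
  have := lasryLions_le_of_isMaxOn_doubled hk hU hy hmax hx₀ x₀ hy'
  rw [sub_self, inner_zero_right] at this
  linarith

/-- A paraboloid centred at `y` touches the regularization from below at `x₀`, so the gradients
agree. -/
lemma gradient_lasryLions_eq (hk : 0 < k) (hU : BddAbove (U '' K)) {P : E → E}
    (hP : ∀ x v, |lasryLions k K U (x + v) - lasryLions k K U x - inner ℝ (P x) v| ≤
      3 * k * ‖v‖ ^ 2) (hy : y ∈ K) {x₀ : E}
    (h : lasryLions k K U x₀ = U y - k * ‖x₀ - y‖ ^ 2) : P x₀ = -((2 * k) • (x₀ - y)) := by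
  rw [← sub_eq_zero, sub_neg_eq_add]
  refine eq_zero_of_inner_ge (C := 4 * k) fun v => ?_
  have h1 := (abs_le.1 (hP x₀ v)).2
  have h2 := sub_sq_le_lasryLions hk hU hy (x₀ + v)
  rw [show x₀ + v - y = x₀ - y + v by abel, norm_add_sq_real] at h2
  rw [inner_add_left, inner_smul_left]
  simp only [conj_trivial]
  linarith

lemma exists_isMaxOn_doubled (k : ℝ) (r : E) (hK : IsCompact K) (hne : K.Nonempty)
    (hU : UpperSemicontinuousOn U K) (hV : UpperSemicontinuousOn V K) :
    ∃ y ∈ K, ∃ y' ∈ K, IsMaxOn (doubled k U V r) (K ×ˢ K) (y, y') := by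
  have h1 : UpperSemicontinuousOn (doubled k U V r) (K ×ˢ K) := by
    have hU' := hU.comp (g := fun z : E × E => z.1) (t := K ×ˢ K) (by fun_prop) fun z hz => hz.1
    have hV' := hV.comp (g := fun z : E × E => z.2) (t := K ×ˢ K) (by fun_prop) fun z hz => hz.2
    have hc : Continuous fun z : E × E =>
        -(k / 2 * ‖z.1 - z.2‖ ^ 2) - 2 * k * inner ℝ r (z.1 + z.2) := by fun_prop
    have h := (hU'.add hV').add hc.continuousOn.upperSemicontinuousOn
    have heq : doubled k U V r = fun z : E × E => (U z.1 + V z.2) +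
        (-(k / 2 * ‖z.1 - z.2‖ ^ 2) - 2 * k * inner ℝ r (z.1 + z.2)) := by
      ext z
      simp only [doubled]
      ring
    rw [heq]
    exact h
  obtain ⟨⟨y, y'⟩, hz, hmax⟩ := h1.exists_isMaxOn (hne.prod hne) (hK.prod hK)
  exact ⟨y, hz.1, y', hz.2, hmax⟩

end Doubling

/-! ### Lipschitz images of null sets and Rademacher's theorem. -/

section NullSets

open MeasureTheory Module

/-- If `P` were differentiable nowhere on `s`, then `s` would be null by Rademacher, and so would
its Lipschitz image, which contains an open set. -/
lemma LipschitzWith.exists_mem_image_of_ae {E : Type*} [NormedAddCommGroup E] [NormedSpace ℝ E]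
    [FiniteDimensional ℝ E] [MeasurableSpace E] [BorelSpace E] {C C' : NNReal} {f P : E → E}
    (hf : LipschitzWith C f) (hP : LipschitzWith C' P) {s : Set E} (hs : (interior (f '' s)).Nonempty) :
    ∃ x ∈ s, DifferentiableAt ℝ P x := by
  by_contra! hcon
  have h1 : (μH[finrank ℝ E] : Measure E) s = 0 :=
    measure_mono_null (fun x hx => hcon x hx) (ae_iff.1 hP.ae_differentiableAt)
  have h2 : (μH[finrank ℝ E] : Measure E) (f '' s) = 0 := by
    have := hf.hausdorffMeasure_image_le (Nat.cast_nonneg (finrank ℝ E)) s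
    rw [h1, mul_zero] at this
    exact le_antisymm this zero_le
  have h3 := isOpen_interior.measure_pos (μH[finrank ℝ E] : Measure E) hs
  exact h3.ne' (measure_mono_null interior_subset h2)

end NullSets

/-! ### The theorem on sums. -/

section SumTheorem

variable {E : Type*} [NormedAddCommGroup E] [InnerProductSpace ℝ E] [FiniteDimensional ℝ E]

/-- A theorem on sums: for arbitrarily small `r` the perturbed doubled functional has a maximum
point at which `U` and `V` have second order upper expansions with opposite quadratic parts. -/
theorem exists_doubled_expansions {k δ : ℝ} (hk : 0 < k) (hδ : 0 < δ) {K : Set E}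
    (hK : IsCompact K) (hne : K.Nonempty) {U V : E → ℝ} (hU : UpperSemicontinuousOn U K)
    (hV : UpperSemicontinuousOn V K) :
    ∃ r : E, ‖r‖ < δ ∧ ∃ y ∈ K, ∃ y' ∈ K, IsMaxOn (doubled k U V r) (K ×ˢ K) (y, y') ∧
      ∃ (q q' : E) (A : E →L[ℝ] E), ∀ η > 0, ∀ᶠ d in 𝓝 (0 : E),
        (y + d ∈ K → U (y + d) ≤ U y + inner ℝ q d + 1 / 2 * inner ℝ (A d) d + η * ‖d‖ ^ 2) ∧
        (y' + d ∈ K →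
          V (y' + d) ≤ V y' + inner ℝ q' d - 1 / 2 * inner ℝ (A d) d + η * ‖d‖ ^ 2) := by
  borelize E
  have hUb := hU.bddAbove_of_isCompact hK
  have hVb := hV.bddAbove_of_isCompact hK
  obtain ⟨P, hP⟩ := exists_abs_lasryLions_sub_le hk hne hUb
  obtain ⟨Q, hQ⟩ := exists_abs_lasryLions_sub_le hk hne hVb
  have hPL := lipschitz_of_abs_sub_sub_inner_le hP (by positivity)
  have hQL := lipschitz_of_abs_sub_sub_inner_le hQ (by positivity)
  set T : Set E := {x | ∃ r : E, ‖r‖ < δ ∧ ∃ y ∈ K, ∃ y' ∈ K,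
    IsMaxOn (doubled k U V r) (K ×ˢ K) (y, y') ∧ x = (1 / 2 : ℝ) • (y + y') - r} with hT
  -- At a contact point the gradients are `-2 * k * (x₀ - y)` and `-2 * k * (x₀ - y')`; their sum is
  -- `4 * k * r`, so every small `w` is reached with `r = w / (4 * k)`.
  have hball : Metric.ball (0 : E) (4 * k * δ) ⊆ (fun x => P x + Q x) '' T := by
    intro w hw
    rw [mem_ball_zero_iff] at hw
    obtain ⟨y, hy, y', hy', hmax⟩ :=
      exists_isMaxOn_doubled k ((1 / (4 * k)) • w) hK hne hU hV
    refine ⟨_, ⟨(1 / (4 * k)) • w, ?_, y, hy, y', hy', hmax, rfl⟩, ?_⟩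
    · rw [norm_smul, Real.norm_of_nonneg (by positivity)]
      field_simp
      linarith
    · have hmax' : IsMaxOn (doubled k V U ((1 / (4 * k)) • w)) (K ×ˢ K) (y', y) := by
        intro z hz
        have := hmax (mk_mem_prod hz.2 hz.1)
        simpa only [mem_ofPred_eq, doubled_swap k U V] using this
      have e1 := gradient_lasryLions_eq hk hUb hP hy
        (lasryLions_eq_of_isMaxOn_doubled hk hUb hy hy' hmax rfl)
      have e2 := gradient_lasryLions_eq hk hVb hQ hy'
        (lasryLions_eq_of_isMaxOn_doubled hk hVb hy' hy hmax' rfl)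
      rw [add_comm y' y] at e2
      simp only [e1, e2]
      match_scalars <;> field_simp <;> ring
  have hint : (interior ((fun x => P x + Q x) '' T)).Nonempty :=
    ⟨0, interior_maximal hball Metric.isOpen_ball (Metric.mem_ball_self (by positivity))⟩
  obtain ⟨x₀, ⟨r, hr, y, hy, y', hy', hmax, hx₀⟩, A, hA⟩ :=
    (hPL.add hQL).exists_mem_image_of_ae hPL hint
  have hx₀y := lasryLions_eq_of_isMaxOn_doubled hk hUb hy hy' hmax hx₀
  -- Moving `x₀` and `y` (or `y'`) by the same `d` leaves the penalties unchanged, so both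
  -- expansions are read off from that of the regularization at `x₀`.
  refine ⟨r, hr, y, hy, y', hy', hmax, P x₀, (4 * k) • r - P x₀, A, fun η hη => ?_⟩
  filter_upwards [eventually_abs_taylor_two_le (hasFDerivAt_of_abs_sub_sub_inner_le hP) hA hη]
    with d hd
  constructor
  · intro hdK
    have h1 := sub_sq_le_lasryLions hk hUb hdK (x₀ + d)
    rw [show x₀ + d - (y + d) = x₀ - y by abel] at h1
    linarith [(abs_le.1 hd).2]
  · intro hdK
    have h1 := lasryLions_le_of_isMaxOn_doubled hk hUb hy hmax hx₀ (x₀ + d) hdK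
    rw [show x₀ + d - (y' + d) = x₀ - y' by abel, add_sub_cancel_left] at h1
    rw [inner_sub_left, inner_smul_left]
    simp only [conj_trivial]
    linarith [(abs_le.1 hd).1]

end SumTheorem

/-! ### Test jets from expansions, and interior points of the monotonicity cone. -/

section Jets

variable {n : ℕ}

/-- The symmetric part of the matrix of an operator. -/
noncomputable def symmPart (L : EuclideanSpace ℝ (Fin n) →L[ℝ] EuclideanSpace ℝ (Fin n)) :
    SymMat n :=
  ⟨Matrix.of fun i j => 1 / 2 *
    (inner ℝ (L (EuclideanSpace.single i 1)) (EuclideanSpace.single j 1) +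
      inner ℝ (L (EuclideanSpace.single j 1)) (EuclideanSpace.single i 1)), by
    rw [selfAdjoint.mem_iff, Matrix.star_eq_conjTranspose]
    ext i j
    simp [add_comm]⟩

lemma symmPart_add_smul_id (L : EuclideanSpace ℝ (Fin n) →L[ℝ] EuclideanSpace ℝ (Fin n)) (c : ℝ) :
    symmPart (L + c • ContinuousLinearMap.id ℝ _) = symmPart L + c • (1 : SymMat n) := by
  have hin : ∀ i j : Fin n, inner ℝ (EuclideanSpace.single i (1 : ℝ))
      (EuclideanSpace.single j (1 : ℝ)) = if i = j then (1 : ℝ) else 0 := by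
    intro i j
    rw [EuclideanSpace.inner_single_left]
    simp [PiLp.single_apply]
  ext i j
  simp only [symmPart, add_apply, smul_apply,
    ContinuousLinearMap.id_apply, inner_add_left, inner_smul_left, conj_trivial, hin,
    Matrix.of_apply, AddSubgroup.coe_add, Matrix.add_apply, selfAdjoint.val_smul,
    selfAdjoint.val_one, Matrix.smul_apply, Matrix.one_apply, smul_eq_mul, eq_comm (a := j) (b := i)]
  split_ifs <;> ring

lemma symmPart_neg (L : EuclideanSpace ℝ (Fin n) →L[ℝ] EuclideanSpace ℝ (Fin n)) :
    symmPart (-L) = -symmPart L := by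
  ext i j
  simp [symmPart]
  ring

/-- The quadratic form sees only the symmetric part of `L`, so `L` need not be known to be
symmetric. -/
lemma mem_upperTestJets_of_expansion {u : EuclideanSpace ℝ (Fin n) → EReal}
    {x₀ q : EuclideanSpace ℝ (Fin n)} {a : ℝ}
    {L : EuclideanSpace ℝ (Fin n) →L[ℝ] EuclideanSpace ℝ (Fin n)} (ha : u x₀ = (a : EReal))
    (h : ∀ᶠ d in 𝓝 (0 : EuclideanSpace ℝ (Fin n)),
      u (x₀ + d) ≤ ((a + inner ℝ q d + 1 / 2 * inner ℝ (L d) d : ℝ) : EReal)) :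
    (a, q, symmPart L) ∈ upperTestJets u x₀ := by
  set B : EuclideanSpace ℝ (Fin n) →L[ℝ] EuclideanSpace ℝ (Fin n) →L[ℝ] ℝ :=
    (innerSL ℝ).comp L with hB
  set φ : EuclideanSpace ℝ (Fin n) → ℝ := fun x =>
    a + innerSL ℝ q (x - x₀) + 1 / 2 * B (x - x₀) (x - x₀) with hφ
  have hd : ∀ x, HasFDerivAt φ
      (innerSL ℝ q + (1 / 2 : ℝ) • ((B + B.flip) (x - x₀))) x := by
    intro x
    have e1 : HasFDerivAt (fun x => x - x₀) (ContinuousLinearMap.id ℝ _) x :=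
      (hasFDerivAt_id x).sub_const x₀
    have e2 := (B.hasFDerivAt.comp x e1).clm_apply e1
    have e3 := (((innerSL ℝ q).hasFDerivAt.comp x e1).const_add a).add (e2.const_mul (1 / 2))
    refine e3.congr_fderiv ?_
    ext v
    simp
  have hd2 : ∀ x, HasFDerivAt (fderiv ℝ φ) ((1 / 2 : ℝ) • (B + B.flip)) x := by
    intro x
    rw [show fderiv ℝ φ = _ from funext fun x => (hd x).fderiv]
    have e1 : HasFDerivAt (fun x => x - x₀) (ContinuousLinearMap.id ℝ _) x :=
      (hasFDerivAt_id x).sub_const x₀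
    exact ((((B + B.flip).hasFDerivAt.comp x e1).const_smul (1 / 2 : ℝ)).const_add _)
  refine ⟨φ, ?_, ?_, ?_, ?_, ?_, ?_⟩
  · have : ContDiff ℝ 2 φ := by fun_prop
    exact this.contDiffAt
  · have ht : Tendsto (fun x => x - x₀) (𝓝 x₀) (𝓝 0) := by
      have : Continuous fun x : EuclideanSpace ℝ (Fin n) => x - x₀ := by fun_prop
      simpa using this.tendsto x₀
    filter_upwards [ht.eventually h] with x hx
    rw [add_sub_cancel] at hx
    exact hx
  · simp [hφ, ha]
  · simp [hφ]
  · have : HasGradientAt φ q x₀ := by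
      rw [hasGradientAt_iff_hasFDerivAt]
      refine (hd x₀).congr_fderiv ?_
      ext v
      simp
    exact this.gradient.symm
  · intro i j
    rw [(hd2 x₀).fderiv]
    rfl

/-- By `|x i * x j| ≤ (x i ^ 2 + x j ^ 2) / 2` the perturbation costs at most `n * t / (n + 1)`
times `∑ i, x i ^ 2`, leaving `t / (n + 1)`. -/
lemma posSemidef_of_abs_sub_le {M : Matrix (Fin n) (Fin n) ℝ} (hM : M.IsHermitian) {t : ℝ}
    (h : ∀ i j, |M i j - (t • (1 : Matrix (Fin n) (Fin n) ℝ)) i j| ≤ t / (n + 1)) :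
    M.PosSemidef := by
  refine .of_dotProduct_mulVec_nonneg hM fun x => ?_
  have hterm : ∀ i j, (if i = j then t * x i ^ 2 else 0) - t / (n + 1) * ((x i ^ 2 + x j ^ 2) / 2) ≤
      x i * (M i j * x j) := by
    intro i j
    have h1 := h i j
    set e := M i j - (t • (1 : Matrix (Fin n) (Fin n) ℝ)) i j with he
    have h2 : M i j = e + (t • (1 : Matrix (Fin n) (Fin n) ℝ)) i j := by rw [he]; ring
    have h3 : -(t / (n + 1) * ((x i ^ 2 + x j ^ 2) / 2)) ≤ e * (x i * x j) := by
      have h4 : |e * (x i * x j)| ≤ t / (n + 1) * ((x i ^ 2 + x j ^ 2) / 2) := by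
        rw [abs_mul]
        have h5 : |x i * x j| ≤ (x i ^ 2 + x j ^ 2) / 2 :=
          abs_le.2 ⟨by nlinarith [sq_nonneg (x i + x j)], by nlinarith [sq_nonneg (x i - x j)]⟩
        exact mul_le_mul h1 h5 (abs_nonneg _) ((abs_nonneg e).trans h1)
      exact (abs_le.1 h4).1
    rw [h2]
    simp only [Matrix.smul_apply, Matrix.one_apply, smul_eq_mul]
    split_ifs with hij
    · subst hij; nlinarith
    · nlinarith
  have hsum := Finset.sum_le_sum fun i (_ : i ∈ Finset.univ) =>
    Finset.sum_le_sum fun j (_ : j ∈ Finset.univ) => hterm i j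
  have hlhs : ∑ i, ∑ j, ((if i = j then t * x i ^ 2 else 0) -
      t / (n + 1) * ((x i ^ 2 + x j ^ 2) / 2)) = (t / (n + 1)) * ∑ i, x i ^ 2 := by
    simp only [Finset.sum_sub_distrib, Finset.sum_ite_eq, Finset.mem_univ, if_true,
      ← Finset.mul_sum, ← Finset.sum_div, Finset.sum_add_distrib, Finset.sum_const,
      Finset.card_univ, Fintype.card_fin, nsmul_eq_mul]
    field_simp
    ring
  rw [hlhs] at hsum
  have hnn : 0 ≤ (t / (n + 1)) * ∑ i, x i ^ 2 := by
    rcases isEmpty_or_nonempty (Fin n) with hn | ⟨⟨i⟩⟩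
    · simp
    · exact mul_nonneg ((abs_nonneg _).trans (h i i)) (Finset.sum_nonneg fun i _ => sq_nonneg _)
  refine (hnn.trans hsum).trans_eq ?_
  simp [dotProduct, Matrix.mulVec, Finset.mul_sum]

lemma eventually_posSemidef {t : ℝ} (ht : 0 < t) :
    ∀ᶠ P : SymMat n in 𝓝 (t • (1 : SymMat n)), (P : Matrix (Fin n) (Fin n) ℝ).PosSemidef := by
  have h : ∀ i j, ∀ᶠ P : SymMat n in 𝓝 (t • (1 : SymMat n)),
      |(P : Matrix (Fin n) (Fin n) ℝ) i j - (t • (1 : Matrix (Fin n) (Fin n) ℝ)) i j| <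
        t / (n + 1) := by
    intro i j
    have hc : Continuous fun P : SymMat n =>
        |(P : Matrix (Fin n) (Fin n) ℝ) i j - (t • (1 : Matrix (Fin n) (Fin n) ℝ)) i j| := by
      have : Continuous fun P : SymMat n => (P : Matrix (Fin n) (Fin n) ℝ) i j :=
        continuous_subtype_val.matrix_elem i j
      exact (this.sub continuous_const).abs
    refine hc.continuousAt.eventually_lt_const ?_
    simp only [selfAdjoint.val_smul, selfAdjoint.val_one, sub_self, abs_zero]
    positivity
  filter_upwards [eventually_all.2 fun i => eventually_all.2 fun j => h i j] with P hP
  exact posSemidef_of_abs_sub_le P.2 fun i j => (hP i j).le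

lemma negPosCone_mem_nhds {s t : ℝ} (hs : s < 0) (ht : 0 < t) (q : EuclideanSpace ℝ (Fin n)) :
    negPosCone n ∈ 𝓝 ((s, q, t • 1) : Jet2 n) := by
  have h1 : Tendsto (fun J : Jet2 n => J.1) (𝓝 (s, q, t • 1)) (𝓝 s) :=
    continuous_fst.tendsto _
  have h2 : Tendsto (fun J : Jet2 n => J.2.2) (𝓝 (s, q, t • 1)) (𝓝 (t • 1)) :=
    (continuous_snd.comp continuous_snd).tendsto _
  filter_upwards [h1.eventually_lt_const hs, h2.eventually (eventually_posSemidef ht)] with J h h'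
  exact ⟨h.le, h'⟩

lemma IsMonotoneSet.add_mem_interior {𝓕 : Set (Jet2 n)} (h : IsMonotoneSet (negPosCone n) 𝓕)
    {J : Jet2 n} (hJ : J ∈ 𝓕) {s t : ℝ} (hs : s < 0) (ht : 0 < t)
    (q : EuclideanSpace ℝ (Fin n)) : J + (s, q, t • 1) ∈ interior 𝓕 := by
  rw [mem_interior_iff_mem_nhds]
  have h1 : Tendsto (fun J' : Jet2 n => J' - J) (𝓝 (J + (s, q, t • 1))) (𝓝 (s, q, t • 1)) := by
    have : Continuous fun J' : Jet2 n => J' - J := by fun_prop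
    have h2 := this.tendsto (J + (s, q, t • 1))
    rwa [add_sub_cancel_left] at h2
  filter_upwards [h1 (negPosCone_mem_nhds hs ht q)] with J' hJ'
  simpa using h J hJ _ hJ'

end Jets

/-! ### Truncation to real values, and the penalty. -/

section Truncation

variable {X : Type*} [TopologicalSpace X]

/-- The real-valued truncation from below of an extended-real-valued function. -/
noncomputable def truncReal (N : ℝ) (u : X → EReal) (x : X) : ℝ :=
  (max (u x) ((-N : ℝ) : EReal)).toReal

variable {N : ℝ} {u : X → EReal} {x : X}

omit [TopologicalSpace X] in
lemma coe_truncReal (hx : u x ≠ ⊤) : (truncReal N u x : EReal) = max (u x) ((-N : ℝ) : EReal) := by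
  refine EReal.coe_toReal ?_ ?_
  · rcases max_choice (u x) ((-N : ℝ) : EReal) with h | h <;> rw [h]
    · exact hx
    · exact EReal.coe_ne_top _
  · exact ((EReal.bot_lt_coe _).trans_le (le_max_right _ _)).ne'

lemma upperSemicontinuousOn_truncReal {s : Set X} (hu : UpperSemicontinuousOn u s)
    (htop : ∀ x ∈ s, u x ≠ ⊤) : UpperSemicontinuousOn (truncReal N u) s := by
  intro x hx a ha
  rw [← EReal.coe_lt_coe_iff, coe_truncReal (htop x hx), max_lt_iff] at ha
  filter_upwards [hu x hx a ha.1, self_mem_nhdsWithin] with y hy hys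
  rw [← EReal.coe_lt_coe_iff, coe_truncReal (htop y hys)]
  exact max_lt hy ha.2

end Truncation

/-- A large quadratic penalty forces almost-coincidence, hence separation from `S`. -/
lemma exists_penalty {E : Type*} [NormedAddCommGroup E] {K S : Set E} (hK : IsCompact K)
    (hS : IsClosed S) {U V : E → ℝ} (hU : UpperSemicontinuousOn U K)
    (hV : UpperSemicontinuousOn V K) {m : ℝ} (hm : ∀ a ∈ K ∩ S, U a + V a < m) :
    ∃ k > 0, ∀ a ∈ K, ∀ b ∈ K, a ∈ S ∨ b ∈ S → U a + V b - k / 2 * ‖a - b‖ ^ 2 < m := by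
  set Z : Set (E × E) := (K ×ˢ K) ∩ {z | z.1 ∈ S ∨ z.2 ∈ S} with hZ
  have hZc : IsCompact Z := (hK.prod hK).inter_right
    ((hS.preimage continuous_fst).union (hS.preimage continuous_snd))
  obtain ⟨B, hB⟩ := hU.bddAbove_of_isCompact hK
  obtain ⟨B', hB'⟩ := hV.bddAbove_of_isCompact hK
  have key : ∃ k₀ : ℝ, ∀ k ≥ k₀, ∀ z ∈ Z, U z.1 + V z.2 - k / 2 * ‖z.1 - z.2‖ ^ 2 < m := by
    -- Compactness reduces the bound to neighbourhoods of points. On the diagonal `hm` and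
    -- semicontinuity suffice for all `k ≥ 0`; off it a large `k` beats the upper bounds of `U` and
    -- `V`.
    refine hZc.induction_on (p := fun t => ∃ k₀ : ℝ, ∀ k ≥ k₀, ∀ z ∈ t,
      U z.1 + V z.2 - k / 2 * ‖z.1 - z.2‖ ^ 2 < m) ⟨0, by simp⟩ ?_ ?_ ?_
    · rintro s t hst ⟨k₀, h⟩
      exact ⟨k₀, fun k hk z hz => h k hk z (hst hz)⟩
    · rintro s t ⟨k₀, h⟩ ⟨k₁, h'⟩
      refine ⟨max k₀ k₁, fun k hk z hz => ?_⟩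
      rcases hz with hz | hz
      · exact h k ((le_max_left _ _).trans hk) z hz
      · exact h' k ((le_max_right _ _).trans hk) z hz
    · rintro ⟨a, b⟩ ⟨⟨ha, hb⟩, hab⟩
      by_cases hne : a = b
      · subst hne
        have haS : a ∈ S := hab.elim id id
        have hU' := hU.comp (g := fun z : E × E => z.1) (t := Z) (by fun_prop) fun z hz => hz.1.1
        have hV' := hV.comp (g := fun z : E × E => z.2) (t := Z) (by fun_prop) fun z hz => hz.1.2
        refine ⟨_, (hU'.add hV') (a, a) ⟨⟨ha, hb⟩, hab⟩ m (hm a ⟨ha, haS⟩), 0, fun k hk z hz => ?_⟩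
        have hz' : U z.1 + V z.2 < m := hz
        have : 0 ≤ k / 2 * ‖z.1 - z.2‖ ^ 2 := by positivity
        linarith
      · have hd : 0 < ‖a - b‖ := norm_pos_iff.2 (sub_ne_zero.2 hne)
        have hc : Continuous fun z : E × E => ‖z.1 - z.2‖ := by fun_prop
        have hev : ∀ᶠ z in 𝓝[Z] (a, b), ‖a - b‖ / 2 < ‖z.1 - z.2‖ :=
          nhdsWithin_le_nhds (hc.continuousAt.eventually_const_lt (by simp only; linarith))
        refine ⟨_, hev.and self_mem_nhdsWithin,
          8 * (|B| + |B'| + |m| + 1) / ‖a - b‖ ^ 2, fun k hk z hz => ?_⟩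
        have h1 := hB (mem_image_of_mem U hz.2.1.1)
        have h2 := hB' (mem_image_of_mem V hz.2.1.2)
        have h3 : (‖a - b‖ / 2) ^ 2 ≤ ‖z.1 - z.2‖ ^ 2 := by gcongr; exact hz.1.le
        have hk0 : 0 ≤ k := le_trans (by positivity) hk
        have h4 : 8 * (|B| + |B'| + |m| + 1) ≤ k * ‖a - b‖ ^ 2 := by
          rwa [ge_iff_le, div_le_iff₀ (by positivity)] at hk
        have h5 := mul_le_mul_of_nonneg_left h3 hk0
        linarith [le_abs_self B, le_abs_self B', neg_abs_le m]
  obtain ⟨k₀, h⟩ := key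
  exact ⟨max k₀ 1, lt_of_lt_of_le one_pos (le_max_right _ _),
    fun a ha b hb hab => h _ (le_max_left _ _) (a, b) ⟨⟨ha, hb⟩, hab⟩⟩

/-! ### The zero maximum principle for sums. -/

section Comparison

variable {n : ℕ}

lemma le_zero_of_truncReal_add_le {u v : EuclideanSpace ℝ (Fin n) → EReal} {B N : ℝ}
    {x : EuclideanSpace ℝ (Fin n)} (hu : u x ≠ ⊤) (hv : v x ≠ ⊤) (hB : 0 ≤ B) (hN : B < N)
    (huB : u x ≤ B) (hvB : v x ≤ B) (h : u x + v x ≤ 0) :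
    truncReal N u x + truncReal N v x ≤ 0 := by
  have hneg : -N ≤ B := by linarith
  have h1 : truncReal N u x ≤ B := by
    rw [← EReal.coe_le_coe_iff, coe_truncReal hu]
    exact max_le huB (EReal.coe_le_coe_iff.2 hneg)
  have h2 : truncReal N v x ≤ B := by
    rw [← EReal.coe_le_coe_iff, coe_truncReal hv]
    exact max_le hvB (EReal.coe_le_coe_iff.2 hneg)
  by_cases hu' : u x ≤ ((-N : ℝ) : EReal)
  · have : truncReal N u x = -N := by
      rw [← EReal.coe_eq_coe_iff, coe_truncReal hu, max_eq_right hu']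
    linarith
  by_cases hv' : v x ≤ ((-N : ℝ) : EReal)
  · have : truncReal N v x = -N := by
      rw [← EReal.coe_eq_coe_iff, coe_truncReal hv, max_eq_right hv']
    linarith
  rw [← EReal.coe_le_coe_iff, EReal.coe_add, coe_truncReal hu, coe_truncReal hv,
    max_eq_left (not_le.1 hu').le, max_eq_left (not_le.1 hv').le]
  exact h

lemma eq_truncReal_of_lt {u : EuclideanSpace ℝ (Fin n) → EReal} {N : ℝ}
    {x : EuclideanSpace ℝ (Fin n)} (hu : u x ≠ ⊤) (h : -N < truncReal N u x) :
    u x = truncReal N u x := by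
  rw [← EReal.coe_lt_coe_iff, coe_truncReal hu, lt_max_iff] at h
  rw [coe_truncReal hu, max_eq_left]
  rcases h with h | h
  · exact h.le
  · exact absurd h (lt_irrefl _)

lemma le_truncReal {u : EuclideanSpace ℝ (Fin n) → EReal} {N : ℝ}
    {x : EuclideanSpace ℝ (Fin n)} (hu : u x ≠ ⊤) : u x ≤ truncReal N u x := by
  rw [coe_truncReal hu]
  exact le_max_left _ _

/-- Comparison: sums of `𝓕`- and `𝓕~`-subharmonics satisfy the zero maximum principle, for every
`𝒩 × ℝⁿ × 𝒫`-monotone set `𝓕`. -/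
theorem IsMonotoneSet.add_nonpos {𝓕 : Set (Jet2 n)} (hF : IsMonotoneSet (negPosCone n) 𝓕)
    {Ω : Set (EuclideanSpace ℝ (Fin n))} (hΩ : IsOpen Ω) (hb : Bornology.IsBounded Ω)
    {u v : EuclideanSpace ℝ (Fin n) → EReal} (hu : IsUSC u (closure Ω)) (hv : IsUSC v (closure Ω))
    (hu𝓕 : ∀ x ∈ Ω, upperTestJets u x ⊆ 𝓕) (hv𝓕 : ∀ x ∈ Ω, upperTestJets v x ⊆ dualSet 𝓕)
    (hbd : ∀ x ∈ frontier Ω, u x + v x ≤ 0) : ∀ x ∈ Ω, u x + v x ≤ 0 := by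
  intro x₁ hx₁
  by_contra! hpos
  have hx₁' : x₁ ∈ closure Ω := subset_closure hx₁
  have hK : IsCompact (closure Ω) := hb.isCompact_closure
  obtain ⟨B, hB, huB, hvB⟩ : ∃ B : ℝ, 0 ≤ B ∧ (∀ x ∈ closure Ω, u x ≤ B) ∧
      ∀ x ∈ closure Ω, v x ≤ B := by
    obtain ⟨B₁, h₁⟩ :=
      (upperSemicontinuousOn_truncReal (N := 0) hu.1 hu.2).bddAbove_of_isCompact hK
    obtain ⟨B₂, h₂⟩ :=
      (upperSemicontinuousOn_truncReal (N := 0) hv.1 hv.2).bddAbove_of_isCompact hK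
    refine ⟨max 0 (max B₁ B₂), le_max_left _ _, fun x hx => ?_, fun x hx => ?_⟩
    · refine (le_truncReal (N := 0) (hu.2 x hx)).trans (EReal.coe_le_coe_iff.2 ?_)
      exact (h₁ (mem_image_of_mem _ hx)).trans ((le_max_left _ _).trans (le_max_right _ _))
    · refine (le_truncReal (N := 0) (hv.2 x hx)).trans (EReal.coe_le_coe_iff.2 ?_)
      exact (h₂ (mem_image_of_mem _ hx)).trans ((le_max_right _ _).trans (le_max_right _ _))
  obtain ⟨R, hR, hRb⟩ : ∃ R : ℝ, 0 < R ∧ ∀ x ∈ closure Ω, ‖x‖ ≤ R := by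
    obtain ⟨R, hR⟩ := hK.isBounded.exists_norm_le
    exact ⟨max R 1, lt_max_of_lt_right one_pos, fun x hx => (hR x hx).trans (le_max_left _ _)⟩
  -- Both truncations are at most `B < N`, so where their sum is positive neither equals `-N` and
  -- both agree with `u` and `v`.
  set N := B + 1 with hN
  set U₀ := truncReal N u with hU₀
  set V := truncReal N v with hV
  have hU₀B : ∀ x ∈ closure Ω, U₀ x ≤ B := fun x hx => by
    rw [← EReal.coe_le_coe_iff, hU₀, coe_truncReal (hu.2 x hx)]
    exact max_le (huB x hx) (EReal.coe_le_coe_iff.2 (by linarith))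
  have hVB : ∀ x ∈ closure Ω, V x ≤ B := fun x hx => by
    rw [← EReal.coe_le_coe_iff, hV, coe_truncReal (hv.2 x hx)]
    exact max_le (hvB x hx) (EReal.coe_le_coe_iff.2 (by linarith))
  obtain ⟨θ, hθ, hθx⟩ : ∃ θ > 0, 2 * θ = U₀ x₁ + V x₁ := by
    refine ⟨(U₀ x₁ + V x₁) / 2, half_pos ?_, by ring⟩
    rw [← EReal.coe_lt_coe_iff, EReal.coe_add]
    exact hpos.trans_le (add_le_add (le_truncReal (hu.2 _ hx₁')) (le_truncReal (hv.2 _ hx₁')))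
  -- Keeps the added quadratic term below `θ / 2` on the closure, a quarter of the value `2 * θ` at
  -- `x₁`.
  set ε := θ / R ^ 2 with hε
  have hε0 : 0 < ε := by positivity
  have hεR : ∀ x ∈ closure Ω, ε / 2 * ‖x‖ ^ 2 ≤ θ / 2 := by
    intro x hx
    have h1 : ‖x‖ ^ 2 ≤ R ^ 2 := by gcongr; exact hRb x hx
    calc ε / 2 * ‖x‖ ^ 2 ≤ ε / 2 * R ^ 2 := by gcongr
      _ = θ / 2 := by rw [hε]; field_simp
  set U : EuclideanSpace ℝ (Fin n) → ℝ := fun x => U₀ x + ε / 2 * ‖x‖ ^ 2 with hU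
  have hUusc : UpperSemicontinuousOn U (closure Ω) :=
    (upperSemicontinuousOn_truncReal hu.1 hu.2).add
      (Continuous.continuousOn (by fun_prop)).upperSemicontinuousOn
  have hVusc : UpperSemicontinuousOn V (closure Ω) := upperSemicontinuousOn_truncReal hv.1 hv.2
  obtain ⟨k, hk, hpen⟩ := exists_penalty hK (isClosed_frontier (s := Ω)) hUusc hVusc (m := θ)
    (fun a ha => by
      have h1 := le_zero_of_truncReal_add_le (N := N) (hu.2 a ha.1) (hv.2 a ha.1) hB (by linarith)
        (huB a ha.1) (hvB a ha.1) (hbd a ha.2)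
      have h2 := hεR a ha.1
      simp only [hU]
      linarith)
  -- This `δ` bounds the linear perturbation by `θ / 2`. Used at `(x₁, x₁)` and at the maximum, it
  -- costs at most `θ` out of `2 * θ`.
  obtain ⟨r, hr, y, hy, y', hy', hmax, q, q', A, hexp⟩ := exists_doubled_expansions hk
    (δ := θ / (8 * k * R)) (by positivity) hK ⟨x₁, hx₁'⟩ hUusc hVusc
  have hlin : ∀ a ∈ closure Ω, ∀ b ∈ closure Ω, |2 * k * inner ℝ r (a + b)| ≤ θ / 2 := by
    intro a ha b hb
    rw [abs_mul, abs_of_pos (by positivity : 0 < 2 * k)]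
    calc 2 * k * |inner ℝ r (a + b)| ≤ 2 * k * (‖r‖ * ‖a + b‖) := by
          gcongr; exact abs_real_inner_le_norm _ _
      _ ≤ 2 * k * (θ / (8 * k * R) * (R + R)) := by
          gcongr
          exact (norm_add_le _ _).trans (add_le_add (hRb a ha) (hRb b hb))
      _ = θ / 2 := by field_simp; ring
  have hlarge : θ ≤ U y + V y' - k / 2 * ‖y - y'‖ ^ 2 := by
    have h1 : doubled k U V r (x₁, x₁) ≤ doubled k U V r (y, y') := hmax (mk_mem_prod hx₁' hx₁')
    simp only [doubled, sub_self, norm_zero] at h1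
    have h2 := (abs_le.1 (hlin y hy y' hy')).1
    have h3 := (abs_le.1 (hlin x₁ hx₁' x₁ hx₁')).2
    have h4 : U₀ x₁ ≤ U x₁ := le_add_of_nonneg_right (by positivity)
    linarith
  have hint : y ∈ Ω ∧ y' ∈ Ω := by
    have h1 : ¬(y ∈ frontier Ω ∨ y' ∈ frontier Ω) := fun h =>
      absurd (hpen y hy y' hy' h) (not_lt.2 hlarge)
    rw [hΩ.frontier_eq] at h1
    by_contra h2
    refine h1 ?_
    by_cases h3 : y ∈ Ω
    · exact Or.inr ⟨hy', fun h4 => h2 ⟨h3, h4⟩⟩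
    · exact Or.inl ⟨hy, h3⟩
  have hsum : 0 < U₀ y + V y' := by
    have h1 := hεR y hy
    have h2 : 0 ≤ k / 2 * ‖y - y'‖ ^ 2 := by positivity
    simp only [hU] at hlarge
    linarith
  have huy : u y = U₀ y := eq_truncReal_of_lt (hu.2 y hy) (by
    have := hVB y' hy'
    change -N < U₀ y
    linarith)
  have hvy : v y' = V y' := eq_truncReal_of_lt (hv.2 y' hy') (by
    have := hU₀B y hy
    change -N < V y'
    linarith)
  have hmem : ∀ z ∈ Ω, ∀ᶠ d in 𝓝 (0 : EuclideanSpace ℝ (Fin n)), z + d ∈ Ω := by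
    intro z hz
    have : Tendsto (fun d => z + d) (𝓝 0) (𝓝 z) := by
      have h := (continuous_const_add z).tendsto 0
      rwa [add_zero] at h
    exact this (hΩ.mem_nhds hz)
  -- Removing `ε / 2 * ‖x‖ ^ 2` subtracts `ε` from the Hessian and the error `ε / 8 * ‖d‖ ^ 2` adds
  -- `ε / 4`, leaving `-3 / 4 * ε`; for `v` only the latter occurs.
  have hJu := hu𝓕 y hint.1 (mem_upperTestJets_of_expansion (q := q - ε • y)
    (L := A + (-(3 / 4 * ε)) • ContinuousLinearMap.id ℝ _) huy (by
      filter_upwards [hexp (ε / 8) (by positivity), hmem y hint.1] with d hd hdΩ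
      have hdK := subset_closure hdΩ
      refine (le_truncReal (N := N) (hu.2 _ hdK)).trans (EReal.coe_le_coe_iff.2 ?_)
      have h1 := hd.1 hdK
      simp only [hU] at h1
      rw [norm_add_sq_real] at h1
      simp only [add_apply, smul_apply, ContinuousLinearMap.id_apply, inner_add_left,
        inner_sub_left, inner_smul_left, conj_trivial, real_inner_self_eq_norm_sq]
      change U₀ (y + d) ≤ _
      linarith))
  have hJv := hv𝓕 y' hint.2 (mem_upperTestJets_of_expansion (q := q')
    (L := -A + (1 / 4 * ε) • ContinuousLinearMap.id ℝ _) hvy (by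
      filter_upwards [hexp (ε / 8) (by positivity), hmem y' hint.2] with d hd hdΩ
      have hdK := subset_closure hdΩ
      refine (le_truncReal (N := N) (hv.2 _ hdK)).trans (EReal.coe_le_coe_iff.2 ?_)
      have h1 := hd.2 hdK
      simp only [add_apply, smul_apply, neg_apply, ContinuousLinearMap.id_apply, inner_add_left,
        inner_neg_left, inner_smul_left, conj_trivial, real_inner_self_eq_norm_sq]
      change V (y' + d) ≤ _
      linarith))
  rw [symmPart_add_smul_id] at hJu hJv
  rw [symmPart_neg] at hJv
  refine hJv ?_
  -- The Hessians `A - ε / 4` (minus that of `v`) and `A - 3 / 4 * ε` differ by `ε / 2`, the values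
  -- by the negative number `-(U₀ y + V y')`, and the gradient gap is free.
  have := hF.add_mem_interior hJu (s := -(U₀ y + V y')) (t := ε / 2) (by linarith) (by positivity)
    (-q' - (q - ε • y))
  convert this using 1
  refine Prod.ext ?_ (Prod.ext ?_ ?_)
  · simp
  · simp
  · change -(-symmPart A + (1 / 4 * ε) • (1 : SymMat n)) =
      symmPart A + (-(3 / 4 * ε)) • (1 : SymMat n) + (ε / 2) • (1 : SymMat n)
    module

end Comparison

/-! ### Operators, level sets and supersolutions. -/

section Duality

variable {n : ℕ}

lemma IsJetAt.neg {φ : EuclideanSpace ℝ (Fin n) → ℝ} {x : EuclideanSpace ℝ (Fin n)} {J : Jet2 n}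
    (h : IsJetAt φ x J) : IsJetAt (fun y => -φ y) x (-J) := by
  have hfd : ∀ y, fderiv ℝ (fun y => -φ y) y = -fderiv ℝ φ y := fun y => fderiv_fun_neg
  refine ⟨by simp [h.1], ?_, fun i j => ?_⟩
  · rw [gradient, hfd, map_neg, ← gradient, ← h.2.1]
    rfl
  · rw [show fderiv ℝ (fun y => -φ y) = fun y => -fderiv ℝ φ y from funext hfd, fderiv_fun_neg]
    change -((J.2.2 : Matrix (Fin n) (Fin n) ℝ) i j) = _
    rw [h.2.2 i j]
    rfl

lemma neg_mem_upperTestJets {w : EuclideanSpace ℝ (Fin n) → EReal} {x : EuclideanSpace ℝ (Fin n)}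
    {J : Jet2 n} (h : J ∈ lowerTestJets w x) : -J ∈ upperTestJets (fun y => -w y) x := by
  obtain ⟨φ, h1, h2, h3, h4⟩ := h
  refine ⟨fun y => -φ y, h1.neg, ?_, ?_, h4.neg⟩
  · filter_upwards [h2] with y hy
    rw [EReal.coe_neg]
    exact EReal.neg_le_neg_iff.2 hy
  · simp only [h3, EReal.coe_neg]

lemma neg_mem_lowerTestJets {w : EuclideanSpace ℝ (Fin n) → EReal} {x : EuclideanSpace ℝ (Fin n)}
    {J : Jet2 n} (h : J ∈ upperTestJets (fun y => -w y) x) : -J ∈ lowerTestJets w x := by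
  obtain ⟨φ, h1, h2, h3, h4⟩ := h
  refine ⟨fun y => -φ y, h1.neg, ?_, ?_, h4.neg⟩
  · filter_upwards [h2] with y hy
    rw [EReal.coe_neg]
    exact EReal.neg_le_of_neg_le hy
  · rw [EReal.coe_neg, ← h3, neg_neg]

lemma isUSC_neg_iff {w : EuclideanSpace ℝ (Fin n) → EReal} {X : Set (EuclideanSpace ℝ (Fin n))} :
    IsUSC (fun x => -w x) X ↔ IsLSC w X := by
  have hval : (∀ x ∈ X, -w x ≠ ⊤) ↔ ∀ x ∈ X, w x ≠ ⊥ := by simp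
  refine and_congr ⟨fun h x hx a ha => ?_, fun h x hx a ha => ?_⟩ hval
  · filter_upwards [h x hx (-a) (EReal.neg_lt_neg_iff.2 ha)] with y hy
    exact EReal.neg_lt_neg_iff.1 hy
  · filter_upwards [h x hx (-a) (EReal.neg_lt_comm.1 ha)] with y hy
    exact EReal.neg_lt_comm.1 hy

lemma IsGradientFreePair.le_add {F : Jet2 n → ℝ} {𝓕 : Set (Jet2 n)} (h : IsGradientFreePair F 𝓕)
    {J J' : Jet2 n} (hJ : J ∈ 𝓕) (hJ' : J' ∈ negPosCone n) :
    J + J' ∈ 𝓕 ∧ F J ≤ F (J + J') := by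
  obtain ⟨G, 𝒢, hG, rfl, hFG⟩ := h
  have hmem : J + J' ∈ {J : Jet2 n | J.reduce ∈ 𝒢} := hG.monotone_set J.reduce hJ J'.reduce hJ'
  refine ⟨hmem, ?_⟩
  rw [hFG J hJ, hFG _ hmem]
  exact hG.monotone_fun J.reduce hJ J'.reduce hJ'

lemma IsGradientFreePair.isMonotoneSet {F : Jet2 n → ℝ} {𝓕 : Set (Jet2 n)}
    (h : IsGradientFreePair F 𝓕) (c : ℝ) :
    IsMonotoneSet (negPosCone n) (upperLevelSet F 𝓕 c) := fun _ hJ _ hJ' =>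
  ⟨(h.le_add hJ.1 hJ').1, hJ.2.trans (h.le_add hJ.1 hJ').2⟩

lemma IsGradientFreePair.mem_interior {F : Jet2 n → ℝ} {𝓕 : Set (Jet2 n)}
    (h : IsGradientFreePair F 𝓕) {c : ℝ} (hc : c ∈ F '' 𝓕) {J : Jet2 n} (hJ : J ∈ 𝓕)
    (hcJ : c < F J) : J ∈ interior (upperLevelSet F 𝓕 c) := by
  obtain ⟨G, 𝒢, hG, rfl, hFG⟩ := h
  have hGJ : c < G J.reduce := by rwa [← hFG J hJ]
  have hint : J.reduce ∈ interior 𝒢 := by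
    by_contra hni
    have hfr : J.reduce ∈ frontier 𝒢 := ⟨subset_closure hJ, hni⟩
    -- On the frontier `G = c₀`, whereas an admissible `c` is at least `c₀`, so `c < G` excludes it.
    rcases hG.compatible with rfl | ⟨c₀, hglb, hf⟩
    · simp at hfr
    · rw [hf] at hfr
      obtain ⟨J₁, hJ₁, rfl⟩ := hc
      have h1 := hglb.1 (mem_image_of_mem G (show J₁.reduce ∈ 𝒢 from hJ₁))
      rw [hFG J₁ hJ₁, hfr.2] at hGJ
      exact absurd h1 (not_le.2 hGJ)
  have hcont : ContinuousAt G J.reduce :=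
    hG.continuousOn.continuousAt (mem_interior_iff_mem_nhds.1 hint)
  have hred : Continuous (Jet2.reduce : Jet2 n → RJet2 n) := by
    unfold Jet2.reduce
    fun_prop
  rw [mem_interior_iff_mem_nhds]
  filter_upwards [hred.continuousAt.eventually (hcont.eventually_const_lt hGJ),
    hred.continuousAt.eventually (mem_interior_iff_mem_nhds.1 hint)] with J' h1 h2
  exact ⟨h2, by rw [hFG J' h2]; exact h1.le⟩

/-- If `F J ≤ c`, step slightly down from `J` along the cone, staying in the level set. Near the new
point monotonicity gives `c ≤ F ≤ F J ≤ c`, so a level set has interior, against tameness. -/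
lemma IsGradientFreePair.lt_of_mem_interior {F : Jet2 n → ℝ} {𝓕 : Set (Jet2 n)}
    (h : IsGradientFreePair F 𝓕) (ht : IsTopologicallyTame F 𝓕) {c : ℝ} {J : Jet2 n}
    (hJ : J ∈ interior (upperLevelSet F 𝓕 c)) : c < F J := by
  by_contra! hle
  have hc : Continuous fun t : ℝ => J - ((-t, 0, t • 1) : Jet2 n) := by
    have h1 : Continuous fun t : ℝ => t • (1 : SymMat n) :=
      Continuous.subtype_mk (continuous_id.smul continuous_const) _
    exact continuous_const.sub (continuous_neg.prodMk (continuous_const.prodMk h1))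
  have h0 : Tendsto (fun t : ℝ => J - ((-t, 0, t • 1) : Jet2 n)) (𝓝 0) (𝓝 J) := by
    have h1 := hc.tendsto 0
    have h2 : J - ((-0, 0, (0 : ℝ) • 1) : Jet2 n) = J := by
      rw [neg_zero, zero_smul]
      exact sub_zero J
    rwa [h2] at h1
  have h1 := (h0.eventually (isOpen_interior.mem_nhds hJ)).filter_mono
    (nhdsWithin_le_nhds (s := Ioi 0))
  obtain ⟨t, hti, htpos⟩ := (h1.and self_mem_nhdsWithin).exists
  have hmem : J - ((-t, 0, t • 1) : Jet2 n) ∈ interior {J | J ∈ 𝓕 ∧ F J = c} := by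
    rw [mem_interior_iff_mem_nhds]
    have h2 : Tendsto (fun J' : Jet2 n => J - J') (𝓝 (J - ((-t, 0, t • 1) : Jet2 n)))
        (𝓝 ((-t, 0, t • 1) : Jet2 n)) := by
      have : Continuous fun J' : Jet2 n => J - J' := by fun_prop
      have h3 := this.tendsto (J - ((-t, 0, t • 1) : Jet2 n))
      rwa [sub_sub_cancel] at h3
    filter_upwards [mem_interior_iff_mem_nhds.1 hti,
      h2 (negPosCone_mem_nhds (neg_lt_zero.2 htpos) htpos 0)] with J' h3 h4
    have h5 := (h.le_add h3.1 h4).2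
    rw [add_sub_cancel] at h5
    exact ⟨h3.1, le_antisymm (h5.trans hle) h3.2⟩
  rw [ht c] at hmem
  exact hmem

lemma IsGradientFreePair.isAdmissibleSupersolution_iff {F : Jet2 n → ℝ} {𝓕 : Set (Jet2 n)}
    (h : IsGradientFreePair F 𝓕) (ht : IsTopologicallyTame F 𝓕) {c : ℝ} (hc : c ∈ F '' 𝓕)
    {w : EuclideanSpace ℝ (Fin n) → EReal} {Ω : Set (EuclideanSpace ℝ (Fin n))} :
    IsAdmissibleSupersolution F 𝓕 c w Ω ↔ IsSuperharmonic (upperLevelSet F 𝓕 c) w Ω := by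
  refine and_congr isUSC_neg_iff.symm (forall₂_congr fun x _ => ⟨fun hw J hJ hJi => ?_,
    fun hw J hJ => ?_⟩)
  · rcases hw _ (neg_mem_lowerTestJets hJ) with h1 | h1
    · exact absurd (h.lt_of_mem_interior ht hJi) (not_lt.2 h1.2)
    · exact h1 (interior_subset hJi).1
  · by_contra! hcon
    have h1 := hw (neg_mem_upperTestJets hJ)
    rw [dualSet, mem_ofPred_eq, neg_neg] at h1
    exact h1 (h.mem_interior hc hcon.2 (hcon.1 hcon.2))

lemma IsGradientFreePair.comparison {F : Jet2 n → ℝ} {𝓕 : Set (Jet2 n)}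
    (h : IsGradientFreePair F 𝓕) {c : ℝ} {Ω : Set (EuclideanSpace ℝ (Fin n))} (hΩ : IsOpen Ω)
    (hb : Bornology.IsBounded Ω) {u w : EuclideanSpace ℝ (Fin n) → EReal}
    (hu : IsUSC u (closure Ω)) (hw : IsLSC w (closure Ω))
    (hu𝓕 : IsSubharmonic (upperLevelSet F 𝓕 c) u Ω)
    (hw𝓕 : IsSuperharmonic (upperLevelSet F 𝓕 c) w Ω) (hbd : ∀ x ∈ frontier Ω, u x ≤ w x) :
    ∀ x ∈ Ω, u x ≤ w x := by
  have key : ∀ x, u x + -w x ≤ 0 ↔ u x ≤ w x := by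
    intro x
    rw [← sub_eq_add_neg]
    exact EReal.sub_nonpos
  have h1 := (h.isMonotoneSet c).add_nonpos hΩ hb hu (isUSC_neg_iff.2 hw) hu𝓕.2 hw𝓕.2
    fun x hx => (key x).2 (hbd x hx)
  exact fun x hx => (key x).1 (h1 x hx)

end Duality

theorem mainTheorem9 (n : ℕ) :
    -- comparison for gradient-free subequations, as a zero maximum principle for sums
    (∀ 𝓕 : Set (Jet2 n), IsGradientFreeSubequation 𝓕 →
      ∀ Ω : Set (EuclideanSpace ℝ (Fin n)), IsOpen Ω → Bornology.IsBounded Ω →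
      ∀ u v : EuclideanSpace ℝ (Fin n) → EReal,
        IsUSC u (closure Ω) → IsUSC v (closure Ω) →
        IsSubharmonic 𝓕 u Ω → IsSubharmonic (dualSet 𝓕) v Ω →
        (∀ x ∈ frontier Ω, u x + v x ≤ 0) → ∀ x ∈ Ω, u x + v x ≤ 0) ∧
    -- comparison for gradient-free operator-subequation pairs
    (∀ (F : Jet2 n → ℝ) (𝓕 : Set (Jet2 n)), IsGradientFreePair F 𝓕 →
      ∀ Ω : Set (EuclideanSpace ℝ (Fin n)), IsOpen Ω → Bornology.IsBounded Ω →
      ∀ c ∈ F '' 𝓕,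
      (∀ u w : EuclideanSpace ℝ (Fin n) → EReal,
        IsUSC u (closure Ω) → IsLSC w (closure Ω) →
        IsSubharmonic (upperLevelSet F 𝓕 c) u Ω →
        IsSuperharmonic (upperLevelSet F 𝓕 c) w Ω →
        (∀ x ∈ frontier Ω, u x ≤ w x) → ∀ x ∈ Ω, u x ≤ w x) ∧
      (IsTopologicallyTame F 𝓕 →
        (∀ u : EuclideanSpace ℝ (Fin n) → EReal, IsUSC u (closure Ω) →
          (IsAdmissibleSubsolution F 𝓕 c u Ω ↔
            IsSubharmonic (upperLevelSet F 𝓕 c) u Ω)) ∧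
        (∀ w : EuclideanSpace ℝ (Fin n) → EReal, IsLSC w (closure Ω) →
          (IsAdmissibleSupersolution F 𝓕 c w Ω ↔
            IsSuperharmonic (upperLevelSet F 𝓕 c) w Ω)) ∧
        (∀ u w : EuclideanSpace ℝ (Fin n) → EReal,
          IsUSC u (closure Ω) → IsLSC w (closure Ω) →
          IsAdmissibleSubsolution F 𝓕 c u Ω →
          IsAdmissibleSupersolution F 𝓕 c w Ω →
          (∀ x ∈ frontier Ω, u x ≤ w x) → ∀ x ∈ Ω, u x ≤ w x))) := by
  refine ⟨fun 𝓕 h𝓕 Ω hΩ hb u v hu hv hu𝓕 hv𝓕 hbd =>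
    h𝓕.monotone.add_nonpos hΩ hb hu hv hu𝓕.2 hv𝓕.2 hbd, fun F 𝓕 h Ω hΩ hb c hc =>
    ⟨fun u w hu hw hu𝓕 hw𝓕 hbd => h.comparison hΩ hb hu hw hu𝓕 hw𝓕 hbd, fun ht =>
    ⟨fun u _ => Iff.rfl, fun w _ => h.isAdmissibleSupersolution_iff ht hc,
    fun u w hu hw hu𝓕 hw𝓕 hbd => h.comparison hΩ hb hu hw hu𝓕
      ((h.isAdmissibleSupersolution_iff ht hc).1 hw𝓕) hbd⟩⟩⟩
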